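/- Let $G$ be a finite connected plane multigraph (loops and multiple edges allowed) with vertex set $V(G)$ and edges $e_1,\dots,e_E$, each coloured $c$ ("chain") or $s$ ("sheaf"). **W-polynomial.** For a multigraph $H$ with edge colours $\lambda$ in a set $\Lambda$, $W(H)(t,z_1,z_2)\in\mathbb Z[t,z_1,z_2,x_\lambda,y_\lambda:\lambda\in\Lambda]$ is defined recursively: $W(H)=t^{n-1}$ if $H$ has $n\ge 1$ vertices and no edges; for an edge $e$ of colour $\lambda$, $W(H)=(x_\lambda+z_1y_\lambda)W(H/e)$ if $e$ is a bridge, $W(H)=(x_\lambda z_2+y_\lambda)W(H-e)$ if $e$ is a loop, and $W(H)=x_\lambda W(H/e)+y_\lambda W(H-e)$ otherwise; and $W(H_1\sqcup H_2)=t\,W(H_1)W(H_2)$. Here $H-e$ and $H/e$ denote deletion and contraction. **Wiring diagram.** A wiring diagram is a plane 4-valent graph (closed curves without vertices allowed) each of whose vertices ("twist sites") is labelled horizontal or vertical. The wiring diagram $W_G$ of $G$ is the medial graph of $G$: it has one site on each edge of $G$, and, in its checkerboard shading, its shaded regions correspond to the vertices of $G$ (if $G$ is a single vertex without edges, $W_G$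 is a single closed curve). The $i$-th site is horizontal if $e_i$ is coloured $c$ and vertical if $e_i$ is coloured $s$. For $\sigma\in\{0,1\}^E$ the state $(W_G)_\sigma$ is the collection of closed curves obtained by replacing each site by two disjoint arcs: at a horizontal site with $\sigma_i=0$ and at a vertical site with $\sigma_i=1$ the arcs connect the two shaded regions that meet at the site, and at a horizontal site with $\sigma_i=1$ and at a vertical site with $\sigma_i=0$ they separate them. **Twist bracket.** Let $K$ be a field, $A\in K$ with $A\ne 0$, $d=-A^{-2}-A^{2}\neq 0$, and $x_1,\dots,x_E\in K$ (for instance, indeterminates). The (Champanerkar–Kofman) twist bracket of $W_G$ is $$P(A,x_1,\dots,x_E)=\sum_{\sigma\in\{0,1\}^E}\Big(\prod_{i=1}^E (x_i-1)^{\sigma_i}d^{\,1-\sigma_i}\Big)\langle (W_G)_\sigma\rangle ,$$ where the Kauffman bracket of a collection of $n$ disjoint closed curves is $d^{\,n-1}$. **Theorem.** Let $\tilde G$ be the graph $G$ with the edge $e_i$ recoloured by $c_i$ if it was coloured $c$ and by $s_i$ if it was coloured $s$. Then, under the evaluation $$x_{c_i}=1,\qquad y_{c_i}=\frac{x_i-1}{d},\qquad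 x_{s_i}=\frac{x_i-1}{d},\qquad y_{s_i}=1,$$ one has $$d^{E}\,W(\tilde G)(d,d,d)=P(A,x_1,\dots,x_E).$$ -/

import Mathlib

/-! ### Multigraphs: components, contraction, bridges -/

/-- The number of connected components of a multigraph. -/
noncomputable def Graph.componentCount {α β : Type*} (G : Graph α β) : ℕ :=
  Nat.card (Quot fun u v : G.vertexSet => G.Adj u v)

open Classical in
/-- Contraction of an edge `e` with ends `u` and `v`: the edge `e` is removed and its two ends are
identified (the resulting vertex keeps the name `u`). -/
noncomputable def Graph.contractEdge {α β : Type*} (G : Graph α β) (e : β) (u v : α) :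
    Graph α β :=
  (G.deleteEdges {e}).map (Function.update id v u)

/-- An edge is a bridge if deleting it increases the number of connected components. -/
def Graph.IsBridge {α β : Type*} (G : Graph α β) (e : β) : Prop :=
  e ∈ G.edgeSet ∧ G.componentCount < (G.deleteEdges {e}).componentCount

/-! ### The W-polynomial of a multigraph whose edges are coloured by `Λ` -/

/-- The variables of the W-polynomial: `t`, `z₁`, `z₂`, and `x_l`, `y_l` for every colour `l`. -/
inductive WVar (Λ : Type*) where
  | t : WVar Λ
  | z₁ : WVar Λ
  | z₂ : WVar Λ
  | x : Λ → WVar Λ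
  | y : Λ → WVar Λ

open MvPolynomial in
/-- The recursive definition of the W-polynomial, as a relation: `IsWPolynomial c G p` means that
the rules give the value `p` for the multigraph `G` with the edge colouring `c`. -/
inductive IsWPolynomial {α β Λ : Type*} (c : β → Λ) :
    Graph α β → MvPolynomial (WVar Λ) ℤ → Prop
  | edgeless (G : Graph α β) (hE : G.edgeSet = ∅) (hfin : G.vertexSet.Finite)
      (hne : G.vertexSet.Nonempty) :
      IsWPolynomial c G (X .t ^ (G.vertexSet.ncard - 1))
  | bridge (G : Graph α β) (e : β) (u v : α) (p : MvPolynomial (WVar Λ) ℤ)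
      (he : G.IsLink e u v) (hb : G.IsBridge e)
      (hp : IsWPolynomial c (G.contractEdge e u v) p) :
      IsWPolynomial c G ((X (.x (c e)) + X .z₁ * X (.y (c e))) * p)
  | loop (G : Graph α β) (e : β) (u : α) (p : MvPolynomial (WVar Λ) ℤ)
      (he : G.IsLoopAt e u)
      (hp : IsWPolynomial c (G.deleteEdges {e}) p) :
      IsWPolynomial c G ((X (.x (c e)) * X .z₂ + X (.y (c e))) * p)
  | ordinary (G : Graph α β) (e : β) (u v : α) (p q : MvPolynomial (WVar Λ) ℤ)
      (he : G.IsLink e u v) (huv : u ≠ v) (hb : ¬ G.IsBridge e)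
      (hp : IsWPolynomial c (G.contractEdge e u v) p)
      (hq : IsWPolynomial c (G.deleteEdges {e}) q) :
      IsWPolynomial c G (X (.x (c e)) * p + X (.y (c e)) * q)
  | disjointUnion (G G₁ G₂ : Graph α β) (p q : MvPolynomial (WVar Λ) ℤ)
      (hdisj : Disjoint G₁.vertexSet G₂.vertexSet)
      (hV : G.vertexSet = G₁.vertexSet ∪ G₂.vertexSet)
      (hlink : ∀ e u v, G.IsLink e u v ↔ G₁.IsLink e u v ∨ G₂.IsLink e u v)
      (hp : IsWPolynomial c G₁ p) (hq : IsWPolynomial c G₂ q) :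
      IsWPolynomial c G (X .t * p * q)

/-! #### The recursion determines a unique polynomial -/

namespace WPolynomialAux

/-- Identifying two points that were not related lowers the number of classes by one. -/
theorem card_quot_add_edge {X : Type*} [Finite X] {r r' : X → X → Prop} {u v : X}
    (h : ∀ a b, r' a b ↔ r a b ∨ (a = u ∧ b = v) ∨ (a = v ∧ b = u)) :
    (Quot.mk r u = Quot.mk r v → Nat.card (Quot r') = Nat.card (Quot r)) ∧
    (Quot.mk r u ≠ Quot.mk r v → Nat.card (Quot r') + 1 = Nat.card (Quot r)) := by
  classical
  have huv : Quot.mk r' u = Quot.mk r' v := Quot.sound ((h u v).2 (Or.inr (Or.inl ⟨rfl, rfl⟩)))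
  let g : Quot r → Quot r' :=
    Quot.lift (Quot.mk r') fun a b hab => Quot.sound ((h a b).2 (Or.inl hab))
  constructor
  · intro heq
    refine Nat.card_congr ⟨Quot.lift (Quot.mk r) ?_, g, ?_, ?_⟩
    · intro a b hab
      rcases (h a b).1 hab with hab | ⟨rfl, rfl⟩ | ⟨rfl, rfl⟩
      · exact Quot.sound hab
      · exact heq
      · exact heq.symm
    · rintro ⟨a⟩; rfl
    · rintro ⟨a⟩; rfl
  · intro hne
    let f : X → {q : Quot r // q ≠ Quot.mk r v} := fun a =>
      if ha : Quot.mk r a = Quot.mk r v then ⟨Quot.mk r u, hne⟩ else ⟨Quot.mk r a, ha⟩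
    have hf : ∀ a b, r' a b → f a = f b := by
      intro a b hab
      rcases (h a b).1 hab with hab | ⟨rfl, rfl⟩ | ⟨rfl, rfl⟩
      · have : Quot.mk r a = Quot.mk r b := Quot.sound hab
        simp only [f, this]
      · simp [f, hne]
      · simp [f, hne]
    have e : Quot r' ≃ {q : Quot r // q ≠ Quot.mk r v} := by
      refine ⟨Quot.lift f hf, fun q => g q.1, ?_, ?_⟩
      · rintro ⟨a⟩
        change g (f a).1 = Quot.mk r' a
        by_cases ha : Quot.mk r a = Quot.mk r v
        · simp only [f, ha, dite_true]
          have h1 : g (Quot.mk r a) = g (Quot.mk r v) := congrArg g ha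
          exact huv.trans h1.symm
        · simp only [f, ha, dite_false]; rfl
      · rintro ⟨⟨a⟩, ha⟩
        change f a = _
        have ha' : ¬ Quot.mk r a = Quot.mk r v := ha
        simp only [f, ha', dite_false]
    rw [Nat.card_congr e]
    have := Nat.card_congr (Equiv.sumCompl fun q : Quot r => q = Quot.mk r v)
    rw [Nat.card_sum, Nat.card_unique] at this
    rw [← this, add_comm]

variable {α β Λ : Type*}

theorem componentCount_add_edge [Finite α] {K K' : Graph α β} {u v : α}
    (hV : K'.vertexSet = K.vertexSet) (hu : u ∈ K.vertexSet) (hv : v ∈ K.vertexSet)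
    (h : ∀ a b, K'.Adj a b ↔ K.Adj a b ∨ (a = u ∧ b = v) ∨ (a = v ∧ b = u)) :
    ((Quot.mk (fun a b : K.vertexSet => K.Adj a b) ⟨u, hu⟩ = Quot.mk _ ⟨v, hv⟩) →
        K'.componentCount = K.componentCount) ∧
    ((Quot.mk (fun a b : K.vertexSet => K.Adj a b) ⟨u, hu⟩ ≠ Quot.mk _ ⟨v, hv⟩) →
        K'.componentCount + 1 = K.componentCount) := by
  have key := card_quot_add_edge (X := K.vertexSet) (r := fun a b => K.Adj a b)
    (r' := fun a b => K'.Adj a b) (u := ⟨u, hu⟩) (v := ⟨v, hv⟩)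
    (by rintro ⟨a, ha⟩ ⟨b, hb⟩; simpa using h a b)
  have hc : K'.componentCount = Nat.card (Quot fun a b : K.vertexSet => K'.Adj a b) := by
    unfold Graph.componentCount; rw [hV]
  rw [hc]; exact key

theorem adj_iff_of_link {H : Graph α β} {e : β} {u v : α} (he : H.IsLink e u v) (a b : α) :
    H.Adj a b ↔ (H.deleteEdges {e}).Adj a b ∨ (a = u ∧ b = v) ∨ (a = v ∧ b = u) := by
  constructor
  · rintro ⟨f, hf⟩
    by_cases hfe : f = e
    · subst hfe
      right
      rcases H.eq_or_eq_of_isLink_of_isLink hf he with h1 | h1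
      · left; subst h1; exact ⟨rfl, Graph.IsLink.right_unique hf he⟩
      · right; subst h1; exact ⟨rfl, Graph.IsLink.right_unique hf he.symm⟩
    · left; exact ⟨f, by simp [hf, hfe]⟩
  · rintro (⟨f, hf⟩ | ⟨rfl, rfl⟩ | ⟨rfl, rfl⟩)
    · exact ⟨f, by simp at hf; exact hf.1⟩
    · exact ⟨e, he⟩
    · exact ⟨e, he.symm⟩

theorem componentCount_contract {H : Graph α β} {e : β} {u v : α} (he : H.IsLink e u v) :
    (H.contractEdge e u v).componentCount = H.componentCount := by
  classical
  set f : α → α := Function.update id v u with hfdef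
  have fv : f v = u := by simp [f]
  have fo : ∀ a, a ≠ v → f a = a := fun a ha => by simp [f, ha]
  have hadj : ∀ a b, (H.contractEdge e u v).Adj a b ↔
      ∃ a' b', (H.deleteEdges {e}).Adj a' b' ∧ f a' = a ∧ f b' = b := by
    intro a b; simp only [Graph.contractEdge, Graph.map_adj, Relation.Map]; rfl
  have hmem : ∀ a ∈ H.vertexSet, f a ∈ (H.contractEdge e u v).vertexSet := by
    intro a ha; exact ⟨a, ha, rfl⟩
  have hsub : ∀ a ∈ (H.contractEdge e u v).vertexSet, a ∈ H.vertexSet := by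
    rintro _ ⟨a, ha, rfl⟩
    by_cases hav : a = v
    · change f a ∈ _; rw [hav, fv]; exact he.left_mem
    · change f a ∈ _; rw [fo a hav]; exact ha
  have hclass : ∀ (a : α) (ha : a ∈ H.vertexSet) (hfa : f a ∈ H.vertexSet),
      Quot.mk (fun a b : H.vertexSet => H.Adj a b) ⟨f a, hfa⟩ = Quot.mk _ ⟨a, ha⟩ := by
    intro a ha hfa
    by_cases hav : a = v
    · subst hav
      refine Quot.sound ?_
      change H.Adj (f a) a
      rw [fv]; exact ⟨e, he⟩
    · congr 2; exact fo a hav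
  have hfix : ∀ a ∈ (H.contractEdge e u v).vertexSet, f a = a := by
    rintro _ ⟨a, ha, rfl⟩
    change f (f a) = f a
    by_cases hav : a = v
    · rw [hav, fv]
      by_cases huv : u = v
      · rw [huv, fv, huv]
      · exact fo u huv
    · rw [fo a hav, fo a hav]
  refine Nat.card_congr ⟨Quot.lift (fun a => Quot.mk _ ⟨a.1, hsub _ a.2⟩) ?_,
    Quot.lift (fun a => Quot.mk _ ⟨f a.1, hmem _ a.2⟩) ?_, ?_, ?_⟩
  · rintro ⟨a, ha⟩ ⟨b, hb⟩ hab
    obtain ⟨a', b', h', h1, h2⟩ := (hadj a b).1 hab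
    subst h1 h2
    have ha' : a' ∈ H.vertexSet := h'.left_mem
    have hb' : b' ∈ H.vertexSet := h'.symm.left_mem
    change Quot.mk _ _ = Quot.mk _ _
    rw [hclass a' ha', hclass b' hb']
    refine Quot.sound ?_
    exact ((adj_iff_of_link he a' b').2 (Or.inl h'))
  · rintro ⟨a, ha⟩ ⟨b, hb⟩ hab
    have hfu : f u = u := by
      by_cases huv : u = v
      · rw [huv, fv, huv]
      · exact fo u huv
    rcases (adj_iff_of_link he a b).1 hab with hab | ⟨h1, h2⟩ | ⟨h1, h2⟩
    · exact Quot.sound ((hadj _ _).2 ⟨a, b, hab, rfl, rfl⟩)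
    · subst h1 h2; congr 2; rw [fv, hfu]
    · subst h1 h2; congr 2; rw [fv, hfu]
  · rintro ⟨⟨a, ha⟩⟩
    change Quot.mk _ _ = Quot.mk _ _
    congr 2
    exact hfix a ha
  · rintro ⟨⟨a, ha⟩⟩
    exact hclass a ha _

theorem ncard_contract [Finite α] {H : Graph α β} {e : β} {u v : α} (he : H.IsLink e u v)
    (huv : u ≠ v) : (H.contractEdge e u v).vertexSet.ncard + 1 = H.vertexSet.ncard := by
  classical
  have : (H.contractEdge e u v).vertexSet = H.vertexSet \ {v} := by
    ext a
    constructor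
    · rintro ⟨b, hb, rfl⟩
      by_cases hbv : b = v
      · subst hbv; simp [he.left_mem, huv]
      · rw [Function.update_of_ne hbv]; exact ⟨hb, hbv⟩
    · rintro ⟨ha, hav⟩
      exact ⟨a, ha, by rw [Function.update_of_ne hav]; rfl⟩
  rw [this]
  exact Set.ncard_sdiff_singleton_add_one he.right_mem (Set.toFinite _)

theorem restrict_insert_contract {H : Graph α β} {e : β} {u v : α} {S : Set β} (_heS : e ∉ S) :
    (H.restrict (insert e S)).contractEdge e u v = (H.contractEdge e u v).restrict S := by
  classical
  refine Graph.ext rfl ?_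
  intro f a b
  simp only [Graph.contractEdge, Graph.map_isLink, Graph.restrict_isLink,
    Graph.deleteEdges_isLink, Relation.Map, Set.mem_singleton_iff, Set.mem_insert_iff]
  constructor
  · rintro ⟨a', b', ⟨⟨h1, h2⟩, h3⟩, h4⟩
    exact ⟨h1.resolve_left h3, a', b', ⟨h2, h3⟩, h4⟩
  · rintro ⟨h1, a', b', ⟨h2, h3⟩, h4⟩
    exact ⟨a', b', ⟨⟨Or.inr h1, h2⟩, h3⟩, h4⟩

theorem restrict_insert_delete {H : Graph α β} {e : β} {S : Set β} (_heS : e ∉ S) :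
    (H.restrict (insert e S)).deleteEdges {e} = (H.deleteEdges {e}).restrict S := by
  refine Graph.ext rfl ?_
  intro f a b
  simp only [Graph.restrict_isLink, Graph.deleteEdges_isLink, Set.mem_singleton_iff,
    Set.mem_insert_iff]
  tauto

theorem restrict_delete {H : Graph α β} {e : β} {S : Set β} (heS : e ∉ S) :
    (H.deleteEdges {e}).restrict S = H.restrict S := by
  refine Graph.ext rfl ?_
  intro f a b
  simp only [Graph.restrict_isLink, Graph.deleteEdges_isLink, Set.mem_singleton_iff]
  constructor
  · rintro ⟨h1, h2, h3⟩; exact ⟨h1, h2⟩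
  · rintro ⟨h1, h2⟩; exact ⟨h1, h2, fun h => heS (h ▸ h1)⟩

theorem quot_mono {H K : Graph α β} (hV : H.vertexSet = K.vertexSet)
    (h : ∀ a b, H.Adj a b → K.Adj a b) {u v : α} (hu : u ∈ H.vertexSet) (hv : v ∈ H.vertexSet)
    (hq : Quot.mk (fun a b : H.vertexSet => H.Adj a b) ⟨u, hu⟩ = Quot.mk _ ⟨v, hv⟩) :
    Quot.mk (fun a b : K.vertexSet => K.Adj a b) ⟨u, hV ▸ hu⟩ = Quot.mk _ ⟨v, hV ▸ hv⟩ :=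
  congrArg (Quot.lift (fun a : H.vertexSet =>
    Quot.mk (fun a b : K.vertexSet => K.Adj a b) ⟨a.1, hV ▸ a.2⟩)
    (fun _ _ hab => Quot.sound (h _ _ hab))) hq

theorem componentCount_loop [Finite α] {H : Graph α β} {e : β} {u : α} (he : H.IsLink e u u) :
    (H.deleteEdges {e}).componentCount = H.componentCount :=
  ((componentCount_add_edge (K := H.deleteEdges {e}) (K' := H) rfl he.left_mem he.left_mem
    (adj_iff_of_link he)).1 rfl).symm

theorem componentCount_nonbridge [Finite α] {H : Graph α β} {e : β} {u v : α}
    (he : H.IsLink e u v) (hb : ¬ H.IsBridge e) :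
    (H.deleteEdges {e}).componentCount = H.componentCount := by
  have h := componentCount_add_edge (K := H.deleteEdges {e}) (K' := H) rfl he.left_mem he.right_mem
    (adj_iff_of_link he)
  by_cases hq : Quot.mk (fun a b : (H.deleteEdges {e}).vertexSet => (H.deleteEdges {e}).Adj a b)
      ⟨u, he.left_mem⟩ = Quot.mk _ ⟨v, he.right_mem⟩
  · exact (h.1 hq).symm
  · have := h.2 hq
    exact absurd ⟨he.edge_mem, by omega⟩ hb

theorem componentCount_bridge [Finite α] {H : Graph α β} {e : β} {u v : α}
    (he : H.IsLink e u v) (hb : H.IsBridge e) {S : Set β} (heS : e ∉ S) :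
    (H.restrict (insert e S)).componentCount + 1 = (H.restrict S).componentCount := by
  have h := componentCount_add_edge (K := H.deleteEdges {e}) (K' := H) rfl he.left_mem he.right_mem
    (adj_iff_of_link he)
  have he' : (H.restrict (insert e S)).IsLink e u v := by simp [he]
  have h' := componentCount_add_edge (K := H.restrict S)
    (K' := H.restrict (insert e S)) rfl he.left_mem he.right_mem (by
      have := adj_iff_of_link he'
      rwa [restrict_insert_delete heS, restrict_delete heS] at this)
  refine h'.2 fun hq => ?_
  have hq' := quot_mono (H := H.restrict S) (K := H.deleteEdges {e}) rfl (by
    rintro a b ⟨f, hf⟩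
    simp only [Graph.restrict_isLink] at hf
    refine ⟨f, ?_⟩
    simp only [Graph.deleteEdges_isLink, Set.mem_singleton_iff]
    exact ⟨hf.2, fun h => heS (h ▸ hf.1)⟩) _ _ hq
  have := h.1 hq'
  exact absurd hb.2 (by omega)

theorem componentCount_edgeless {H : Graph α β} (hE : H.edgeSet = ∅) :
    H.componentCount = H.vertexSet.ncard := by
  have hno : ∀ a b, ¬ H.Adj a b := by
    rintro a b ⟨e, he⟩
    have := he.edge_mem
    rw [hE] at this; exact this
  rw [← Nat.card_coe_set_eq]
  refine Nat.card_congr ⟨Quot.lift id fun a b h => absurd h (hno _ _), Quot.mk _, ?_, ?_⟩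
  · rintro ⟨a⟩; rfl
  · intro a; rfl

theorem componentCount_union [Finite α] {G G₁ G₂ : Graph α β}
    (hdisj : Disjoint G₁.vertexSet G₂.vertexSet)
    (hV : G.vertexSet = G₁.vertexSet ∪ G₂.vertexSet)
    (hadj : ∀ u v, G.Adj u v ↔ G₁.Adj u v ∨ G₂.Adj u v) :
    G.componentCount = G₁.componentCount + G₂.componentCount := by
  classical
  unfold Graph.componentCount
  rw [← Nat.card_sum]
  have hno1 : ∀ a b, G₁.Adj a b → a ∈ G₁.vertexSet ∧ b ∈ G₁.vertexSet :=
    fun a b h => ⟨h.left_mem, h.symm.left_mem⟩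
  have hno2 : ∀ a b, G₂.Adj a b → a ∉ G₁.vertexSet ∧ b ∉ G₁.vertexSet :=
    fun a b h => ⟨fun h' => Set.disjoint_left.1 hdisj h' h.left_mem,
      fun h' => Set.disjoint_left.1 hdisj h' h.symm.left_mem⟩
  have hm : ∀ a ∈ G.vertexSet, a ∉ G₁.vertexSet → a ∈ G₂.vertexSet := by
    intro a ha h; rw [hV] at ha; exact ha.resolve_left h
  let F : G.vertexSet → Quot (fun u v : G₁.vertexSet => G₁.Adj u v) ⊕
      Quot (fun u v : G₂.vertexSet => G₂.Adj u v) := fun a =>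
    if h : a.1 ∈ G₁.vertexSet then Sum.inl (Quot.mk _ ⟨a.1, h⟩)
    else Sum.inr (Quot.mk _ ⟨a.1, hm _ a.2 h⟩)
  refine Nat.card_congr ⟨Quot.lift F ?_, Sum.elim
    (Quot.lift (fun a => Quot.mk _ ⟨a.1, hV ▸ Or.inl a.2⟩) ?_)
    (Quot.lift (fun a => Quot.mk _ ⟨a.1, hV ▸ Or.inr a.2⟩) ?_), ?_, ?_⟩
  · rintro ⟨a, ha⟩ ⟨b, hb⟩ hab
    rcases (hadj a b).1 hab with h | h
    · have := hno1 _ _ h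
      simp only [F, this.1, this.2, dite_true]
      exact congrArg Sum.inl (Quot.sound h)
    · have := hno2 _ _ h
      simp only [F, this.1, this.2, dite_false]
      exact congrArg Sum.inr (Quot.sound h)
  · intro a b h; exact Quot.sound ((hadj _ _).2 (Or.inl h))
  · intro a b h; exact Quot.sound ((hadj _ _).2 (Or.inr h))
  · rintro ⟨⟨a, ha⟩⟩
    change Sum.elim _ _ (F ⟨a, ha⟩) = _
    by_cases h : a ∈ G₁.vertexSet
    · simp only [F, h, dite_true]; rfl
    · simp only [F, h, dite_false]; rfl
  · rintro (⟨⟨a, ha⟩⟩ | ⟨⟨a, ha⟩⟩)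
    · change F _ = _
      simp only [F, ha, dite_true]
    · have h : a ∉ G₁.vertexSet := fun h => Set.disjoint_left.1 hdisj h ha
      change F _ = _
      simp only [F, h, dite_false]

open MvPolynomial Finset

open Classical in
/-- An auxiliary sum over the spanning subgraphs with edge set contained in `E`. -/
noncomputable def subsetSum (c : β → Λ) (G : Graph α β) (E : Finset β) :
    MvPolynomial (WVar Λ) ℤ :=
  ∑ S ∈ E.powerset, (∏ e ∈ S, X (.x (c e))) * (∏ e ∈ E \ S, X (.y (c e))) *
    (X .z₁ ^ (G.restrict (S : Set β)).componentCount *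
      X .z₂ ^ (S.card + (G.restrict (S : Set β)).componentCount))

open Classical in
theorem subsetSum_congr (c : β → Λ) {G H : Graph α β} {E : Finset β}
    (h : ∀ S ⊆ E, (G.restrict (S : Set β)).componentCount =
      (H.restrict (S : Set β)).componentCount) : subsetSum c G E = subsetSum c H E := by
  refine Finset.sum_congr rfl fun S hS => ?_
  rw [h S (Finset.mem_powerset.1 hS)]

open Classical in
theorem subsetSum_insert (c : β → Λ) {G : Graph α β} {E : Finset β} {e : β} {u v : α}
    (he : G.IsLink e u v) (heE : e ∉ E) :
    subsetSum c G (insert e E) = X (.x (c e)) * X .z₂ * subsetSum c (G.contractEdge e u v) E +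
      X (.y (c e)) * subsetSum c (G.deleteEdges {e}) E := by
  unfold subsetSum
  rw [Finset.sum_powerset_insert heE, add_comm, Finset.mul_sum, Finset.mul_sum]
  congr 1
  · refine Finset.sum_congr rfl fun S hS => ?_
    have hS := Finset.mem_powerset.1 hS
    have heS : e ∉ S := fun h => heE (hS h)
    have hk : ((G.contractEdge e u v).restrict (S : Set β)).componentCount =
        (G.restrict ((insert e S : Finset β) : Set β)).componentCount := by
      rw [Finset.coe_insert, ← restrict_insert_contract (by simpa using heS)]
      exact componentCount_contract (by simp [he])
    rw [hk, Finset.prod_insert heS, Finset.card_insert_of_notMem heS,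
      Finset.insert_sdiff_insert, Finset.sdiff_insert_of_notMem heE]
    ring
  · refine Finset.sum_congr rfl fun S hS => ?_
    have hS := Finset.mem_powerset.1 hS
    have heS : e ∉ S := fun h => heE (hS h)
    rw [restrict_delete (by simpa using heS), Finset.insert_sdiff_of_notMem _ heS,
      Finset.prod_insert (fun h => heE (Finset.mem_sdiff.1 h).1)]
    ring

open Classical in
theorem subsetSum_bridge [Finite α] (c : β → Λ) {G : Graph α β} {E : Finset β} {e : β} {u v : α}
    (he : G.IsLink e u v) (hb : G.IsBridge e) (heE : e ∉ E) :
    subsetSum c (G.deleteEdges {e}) E =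
      X .z₁ * X .z₂ * subsetSum c (G.contractEdge e u v) E := by
  unfold subsetSum
  rw [Finset.mul_sum]
  refine Finset.sum_congr rfl fun S hS => ?_
  have hS := Finset.mem_powerset.1 hS
  have heS : e ∉ (S : Set β) := fun h => heE (hS h)
  have hk : ((G.contractEdge e u v).restrict (S : Set β)).componentCount =
      (G.restrict (insert e (S : Set β))).componentCount := by
    rw [← restrict_insert_contract heS]
    exact componentCount_contract (by simp [he])
  rw [hk, restrict_delete heS, ← componentCount_bridge he hb heS]
  ring

open Classical in
theorem subsetSum_union [Finite α] (c : β → Λ) {G G₁ G₂ : Graph α β} {E₁ E₂ : Finset β}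
    (hE₁ : (E₁ : Set β) = G₁.edgeSet) (hE₂ : (E₂ : Set β) = G₂.edgeSet)
    (hE : Disjoint E₁ E₂)
    (hdisj : Disjoint G₁.vertexSet G₂.vertexSet)
    (hV : G.vertexSet = G₁.vertexSet ∪ G₂.vertexSet)
    (hlink : ∀ e u v, G.IsLink e u v ↔ G₁.IsLink e u v ∨ G₂.IsLink e u v) :
    subsetSum c G (E₁ ∪ E₂) = subsetSum c G₁ E₁ * subsetSum c G₂ E₂ := by
  unfold subsetSum
  rw [Finset.sum_mul_sum, ← Finset.sum_product']
  symm
  have hd : ∀ {S T : Finset β}, S ⊆ E₁ → T ⊆ E₂ → Disjoint S T := fun h1 h2 =>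
    Finset.disjoint_of_subset_left h1 (Finset.disjoint_of_subset_right h2 hE)
  refine Finset.sum_bij' (fun p _ => p.1 ∪ p.2) (fun S _ => (S ∩ E₁, S ∩ E₂)) ?_ ?_ ?_ ?_ ?_
  · rintro ⟨S, T⟩ h
    simp only [Finset.mem_product, Finset.mem_powerset] at h ⊢
    exact Finset.union_subset_union h.1 h.2
  · intro S _
    simp
  · rintro ⟨S, T⟩ h
    simp only [Finset.mem_product, Finset.mem_powerset] at h
    have h1 : T ∩ E₁ = ∅ := Finset.disjoint_iff_inter_eq_empty.1
      (Finset.disjoint_of_subset_left h.2 hE.symm)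
    have h2 : S ∩ E₂ = ∅ := Finset.disjoint_iff_inter_eq_empty.1
      (Finset.disjoint_of_subset_left h.1 hE)
    simp [Finset.union_inter_distrib_right, h1, h2, Finset.inter_eq_left.2 h.1,
      Finset.inter_eq_left.2 h.2]
  · intro S hS
    have := Finset.mem_powerset.1 hS
    change S ∩ E₁ ∪ S ∩ E₂ = S
    rw [← Finset.inter_union_distrib_left, Finset.inter_eq_left.2 this]
  · rintro ⟨S, T⟩ h
    simp only [Finset.mem_product, Finset.mem_powerset] at h
    dsimp only
    have hST := hd h.1 h.2
    have hsd : (E₁ ∪ E₂) \ (S ∪ T) = (E₁ \ S) ∪ (E₂ \ T) := by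
      ext f
      have a1 := @h.1 f
      have a2 := @h.2 f
      have a3 : f ∈ E₁ → f ∉ E₂ := fun hf => Finset.disjoint_left.1 hE hf
      simp only [Finset.mem_sdiff, Finset.mem_union]
      tauto
    have hsd' : Disjoint (E₁ \ S) (E₂ \ T) := hd Finset.sdiff_subset Finset.sdiff_subset
    have hk : (G.restrict ((S ∪ T : Finset β) : Set β)).componentCount =
        (G₁.restrict (S : Set β)).componentCount + (G₂.restrict (T : Set β)).componentCount := by
      refine componentCount_union hdisj hV ?_
      intro a b
      simp only [Graph.Adj, Graph.restrict_isLink, Finset.coe_union, Set.mem_union,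
        Finset.mem_coe, ← exists_or]
      refine exists_congr fun f => ?_
      rw [hlink]
      have b1 : G₁.IsLink f a b → f ∈ E₁ := fun hf => by
        have := hf.edge_mem; rw [← hE₁] at this; exact this
      have b2 : G₂.IsLink f a b → f ∈ E₂ := fun hf => by
        have := hf.edge_mem; rw [← hE₂] at this; exact this
      have a1 := @h.1 f
      have a2 := @h.2 f
      have a3 : f ∈ E₁ → f ∉ E₂ := fun hf => Finset.disjoint_left.1 hE hf
      tauto
    rw [hk, hsd, Finset.prod_union hST, Finset.prod_union hsd', Finset.card_union_of_disjoint hST]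
    ring

open Classical in
theorem eq_subsetSum [Finite α] [Fintype β] {c : β → Λ} {G : Graph α β}
    {p : MvPolynomial (WVar Λ) ℤ} (h : IsWPolynomial c G p) :
    p * (X .z₁ ^ G.componentCount * X .z₂ ^ G.vertexSet.ncard * X .t) =
      X .t ^ G.componentCount * subsetSum c G G.edgeSet.toFinset := by
  have hins : ∀ (H : Graph α β) (e : β) (u v : α), H.IsLink e u v →
      H.edgeSet.toFinset = insert e (H.edgeSet \ {e}).toFinset ∧
      e ∉ (H.edgeSet \ {e}).toFinset := by
    intro H e u v he
    refine ⟨?_, by simp⟩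
    ext f
    have := he.edge_mem
    by_cases hf : f = e
    · subst hf; simp [this]
    · simp [hf]
  induction h with
  | edgeless G hE hfin hne =>
    have hpos : 0 < G.vertexSet.ncard := (Set.ncard_pos hfin).2 hne
    have h0 : G.edgeSet.toFinset = ∅ := by simp [hE]
    rw [h0]
    have hk : (G.restrict ((∅ : Finset β) : Set β)).componentCount = G.vertexSet.ncard := by
      rw [componentCount_edgeless (by simp)]; rfl
    obtain ⟨n, hn⟩ : ∃ n, G.vertexSet.ncard = n + 1 := ⟨_, (Nat.succ_pred_eq_of_pos hpos).symm⟩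
    simp only [subsetSum, Finset.powerset_empty, Finset.sum_singleton, hk,
      componentCount_edgeless hE, hn]
    simp
    ring
  | bridge G e u v p he hb hp ih =>
    obtain ⟨h1, h2⟩ := hins G e u v he
    rw [h1, subsetSum_insert c he h2, subsetSum_bridge c he hb h2]
    have huv : u ≠ v := by
      rintro rfl
      have := componentCount_loop he
      exact absurd hb.2 (by omega)
    rw [componentCount_contract he] at ih
    rw [← ncard_contract he huv]
    have hE : (G.contractEdge e u v).edgeSet.toFinset = (G.edgeSet \ {e}).toFinset :=
      Set.toFinset_congr rfl
    rw [hE] at ih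
    linear_combination (X (.x (c e)) + X .z₁ * X (.y (c e))) * X .z₂ * ih
  | loop G e u p he hp ih =>
    have he : G.IsLink e u u := he
    obtain ⟨h1, h2⟩ := hins G e u u he
    rw [h1, subsetSum_insert c he h2]
    have hcd : G.contractEdge e u u = G.deleteEdges {e} := by
      unfold Graph.contractEdge
      have : Function.update (id : α → α) u u = id :=
        Function.update_eq_self u (id : α → α)
      rw [this]
      refine Graph.ext (by simp) ?_
      intro f a b
      simp
    rw [componentCount_loop he] at ih
    have hE : (G.deleteEdges {e}).edgeSet.toFinset = (G.edgeSet \ {e}).toFinset :=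
      Set.toFinset_congr rfl
    rw [hE] at ih
    have hVn : (G.deleteEdges {e}).vertexSet.ncard = G.vertexSet.ncard := rfl
    rw [hVn] at ih
    rw [hcd]
    linear_combination (X (.x (c e)) * X .z₂ + X (.y (c e))) * ih
  | ordinary G e u v p q he huv hb hp hq ihp ihq =>
    obtain ⟨h1, h2⟩ := hins G e u v he
    rw [h1, subsetSum_insert c he h2]
    rw [componentCount_contract he] at ihp
    rw [componentCount_nonbridge he hb] at ihq
    have hE : (G.contractEdge e u v).edgeSet.toFinset = (G.edgeSet \ {e}).toFinset :=
      Set.toFinset_congr rfl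
    have hE' : (G.deleteEdges {e}).edgeSet.toFinset = (G.edgeSet \ {e}).toFinset :=
      Set.toFinset_congr rfl
    rw [hE] at ihp
    rw [hE'] at ihq
    have hVn : (G.deleteEdges {e}).vertexSet.ncard = G.vertexSet.ncard := rfl
    rw [hVn, ← ncard_contract he huv] at ihq
    rw [← ncard_contract he huv]
    linear_combination X (.x (c e)) * X .z₂ * ihp + X (.y (c e)) * ihq
  | disjointUnion G G₁ G₂ p q hdisj hV hlink hp hq ihp ihq =>
    have hEd : Disjoint G₁.edgeSet.toFinset G₂.edgeSet.toFinset := by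
      rw [Finset.disjoint_left]
      intro e h1 h2
      obtain ⟨a, b, hab⟩ := (G₁.edge_mem_iff_exists_isLink e).1 (Set.mem_toFinset.1 h1)
      obtain ⟨a', b', hab'⟩ := (G₂.edge_mem_iff_exists_isLink e).1 (Set.mem_toFinset.1 h2)
      have g1 := (hlink e a b).2 (Or.inl hab)
      have g2 := (hlink e a' b').2 (Or.inr hab')
      rcases G.eq_or_eq_of_isLink_of_isLink g1 g2 with h | h
      · exact Set.disjoint_left.1 hdisj hab.left_mem (h ▸ hab'.left_mem)
      · exact Set.disjoint_left.1 hdisj hab.left_mem (h ▸ hab'.right_mem)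
    have hEu : G.edgeSet.toFinset = G₁.edgeSet.toFinset ∪ G₂.edgeSet.toFinset := by
      ext e
      simp only [Set.mem_toFinset, Finset.mem_union, Graph.edge_mem_iff_exists_isLink, hlink,
        exists_or]
    rw [hEu, subsetSum_union c (by simp) (by simp) hEd hdisj hV hlink,
      componentCount_union hdisj hV (by
        intro a b; simp only [Graph.Adj, hlink, exists_or]),
      hV, Set.ncard_union_eq hdisj (Set.toFinite _) (Set.toFinite _)]
    rw [pow_add, pow_add, pow_add]
    linear_combination (q * (X .z₁ ^ G₂.componentCount * X .z₂ ^ G₂.vertexSet.ncard * X .t)) * ihp +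
      (X .t ^ G₁.componentCount * subsetSum c G₁ G₁.edgeSet.toFinset) * ihq

theorem exists_isWPolynomial [Finite α] [Finite β] (c : β → Λ) (n : ℕ) :
    ∀ G : Graph α β, G.vertexSet.Nonempty → G.edgeSet.ncard = n → ∃ p, IsWPolynomial c G p := by
  induction n with
  | zero =>
    intro G hne hn
    exact ⟨_, .edgeless G ((Set.ncard_eq_zero (Set.toFinite _)).1 hn) (Set.toFinite _) hne⟩
  | succ n ih =>
    intro G hne hn
    obtain ⟨e, heE⟩ : G.edgeSet.Nonempty := (Set.ncard_pos (Set.toFinite _)).1 (by omega)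
    obtain ⟨u, v, he⟩ := (G.edge_mem_iff_exists_isLink e).1 heE
    have hcard : (G.edgeSet \ {e}).ncard = n := by
      have := Set.ncard_sdiff_singleton_add_one heE (Set.toFinite _)
      omega
    obtain ⟨p, hp⟩ := ih (G.contractEdge e u v) (hne.image _) hcard
    obtain ⟨q, hq⟩ := ih (G.deleteEdges {e}) hne hcard
    by_cases hb : G.IsBridge e
    · exact ⟨_, .bridge G e u v p he hb hp⟩
    by_cases huv : u = v
    · subst huv; exact ⟨_, .loop G e u q he hq⟩
    · exact ⟨_, .ordinary G e u v p q he huv hb hp hq⟩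

end WPolynomialAux

/-- On a finite nonempty multigraph the recursive rules determine exactly one polynomial,
whatever the order in which they are applied. -/
theorem existsUnique_isWPolynomial {α β Λ : Type*} [Finite α] [Finite β] (c : β → Λ)
    (G : Graph α β) (hG : G.vertexSet.Nonempty) : ∃! p, IsWPolynomial c G p := by
  classical
  have := Fintype.ofFinite β
  obtain ⟨p, hp⟩ := WPolynomialAux.exists_isWPolynomial c _ G hG rfl
  refine ⟨p, hp, fun q hq => ?_⟩
  have h := (WPolynomialAux.eq_subsetSum hq).trans (WPolynomialAux.eq_subsetSum hp).symm
  refine mul_right_cancel₀ ?_ h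
  exact mul_ne_zero (mul_ne_zero (pow_ne_zero _ (MvPolynomial.X_ne_zero _))
    (pow_ne_zero _ (MvPolynomial.X_ne_zero _))) (MvPolynomial.X_ne_zero _)

open Classical in
/-- The W-polynomial of a finite nonempty multigraph with edge colouring `c`: the polynomial given
by the recursive rules (and `0` where they give none). -/
noncomputable def wPolynomial {α β Λ : Type*} (c : β → Λ) (G : Graph α β) :
    MvPolynomial (WVar Λ) ℤ :=
  if h : ∃ p, IsWPolynomial c G p then h.choose else 0

theorem isWPolynomial_wPolynomial {α β Λ : Type*} [Finite α] [Finite β] (c : β → Λ)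
    (G : Graph α β) (hG : G.vertexSet.Nonempty) : IsWPolynomial c G (wPolynomial c G) := by
  have h := (existsUnique_isWPolynomial c G hG).exists
  unfold wPolynomial
  rw [dif_pos h]
  exact h.choose_spec

/-! ### Multigraphs embedded in an oriented surface, and plane multigraphs -/

/-- A multigraph with vertex type `V` and edge type `E`, cellularly embedded in an oriented surface
(up to homeomorphism; every connected component on a surface of its own), as a rotation system.
Each edge `e` has two darts (half-edges) `(e, false)` and `(e, true)`, one at each end. -/
structure EmbeddedGraph (V E : Type*) where
  /-- The vertex at which a dart sits. -/
  base : E × Bool → V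
  /-- The next dart at the same vertex, in counterclockwise order. -/
  rot : Equiv.Perm (E × Bool)
  /-- The rotation permutes the darts at each vertex cyclically. -/
  sameCycle_iff : ∀ a b, rot.SameCycle a b ↔ base a = base b

namespace EmbeddedGraph

variable {V E : Type*}

/-- The underlying abstract multigraph. -/
def graph (G : EmbeddedGraph V E) : Graph V E where
  vertexSet := Set.univ
  IsLink e u v := (G.base (e, false) = u ∧ G.base (e, true) = v) ∨
    (G.base (e, false) = v ∧ G.base (e, true) = u)
  edgeSet := Set.univ
  isLink_symm _ _ := ⟨fun _ _ h => h.symm⟩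
  eq_or_eq_of_isLink_of_isLink := by
    rintro e x y v w (⟨rfl, rfl⟩ | ⟨rfl, rfl⟩) (⟨rfl, rfl⟩ | ⟨rfl, rfl⟩) <;> simp
  edge_mem_iff_exists_isLink e := by
    simp only [Set.mem_univ, true_iff]
    exact ⟨_, _, Or.inl ⟨rfl, rfl⟩⟩
  left_mem_of_isLink := by intros; trivial

/-- The permutation of the darts that walks around the faces: traverse the edge of a dart from its
base to its other end, keeping the face on the left, and continue with the next dart there in
clockwise order. -/
def facePerm (G : EmbeddedGraph V E) : Equiv.Perm (E × Bool) :=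
  (Equiv.prodCongr (Equiv.refl E) Equiv.boolNot).trans G.rot.symm

/-- The number of vertices without darts. -/
noncomputable def isolatedCount (G : EmbeddedGraph V E) : ℕ :=
  Nat.card {v : V // ∀ a, G.base a ≠ v}

/-- The number of faces: the cycles of the face permutation, and one face for each component that
is a single vertex without edges. -/
noncomputable def faceCount (G : EmbeddedGraph V E) : ℕ :=
  Nat.card (Quotient (Equiv.Perm.SameCycle.setoid G.facePerm)) + G.isolatedCount

/-- The embedding is planar: the surface is a sphere for every connected component, that is, the
Euler characteristic is twice the number of components. -/
def IsPlane (G : EmbeddedGraph V E) : Prop :=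
  Nat.card V + G.faceCount = Nat.card E + 2 * G.graph.componentCount

end EmbeddedGraph

/-! ### Wiring diagrams and the twist bracket -/

/-- The two types of vertices (twist sites) of a wiring diagram. -/
inductive TwistType where
  | horizontal
  | vertical

/-- The four ends at a twist site, in counterclockwise order: north-east, north-west, south-west,
south-east. -/
inductive SiteEnd where
  | ne
  | nw
  | sw
  | se

/-- A wiring diagram with twist sites indexed by `T`: a 4-valent graph (closed curves without
vertices being allowed), with the four ends at each vertex placed in the cyclic order of `SiteEnd`,
whose vertices are horizontal or vertical. Planarity is not a field, as neither the states nor the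
twist bracket depend on it; the wiring diagram of a plane graph is drawn on the same sphere. -/
structure WiringDiagram (T : Type*) where
  /-- The type of each vertex. -/
  type : T → TwistType
  /-- The edges of the 4-valent graph: the other end of the edge that starts at a given end. -/
  strand : T × SiteEnd → T × SiteEnd
  strand_strand : ∀ a, strand (strand a) = a
  strand_ne : ∀ a, strand a ≠ a
  /-- The number of closed curves without vertices. -/
  freeCircles : ℕ

/-- The two arcs `NW - NE` and `SW - SE`: they leave a passage between the regions in the west and
in the east. -/
def SiteEnd.horizontalArcs : SiteEnd → SiteEnd
  | .ne => .nw
  | .nw => .ne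
  | .sw => .se
  | .se => .sw

/-- The two arcs `NW - SW` and `NE - SE`: they separate the regions in the west and in the east. -/
def SiteEnd.verticalArcs : SiteEnd → SiteEnd
  | .ne => .se
  | .se => .ne
  | .nw => .sw
  | .sw => .nw

/-- The fillings of a twist site: the 0-filling has the two arcs parallel to the direction of the
twist (horizontal or vertical), the 1-filling has the other two arcs. -/
def TwistType.filling : TwistType → Fin 2 → SiteEnd → SiteEnd
  | .horizontal, 0 => SiteEnd.horizontalArcs
  | .horizontal, 1 => SiteEnd.verticalArcs
  | .vertical, 0 => SiteEnd.verticalArcs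
  | .vertical, 1 => SiteEnd.horizontalArcs

/-- The loop value `d = -A⁻² - A²`. -/
def loopValue {K : Type*} [Field K] (A : K) : K := -(A ^ 2)⁻¹ - A ^ 2

/-- The Kauffman bracket of a diagram without crossings that consists of `n` closed curves: a
single curve has bracket `1`, every further one multiplies the bracket by `d`. -/
def crossinglessBracket {K : Type*} [Field K] (A : K) (n : ℕ) : K :=
  loopValue A ^ ((n : ℤ) - 1)

namespace WiringDiagram

variable {T : Type*}

/-- The number of closed curves of the state `L_σ`, in which the site `i` has the `σ i`-filling:
two ends are on the same curve if they are linked by strands and arcs of fillings. -/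
noncomputable def stateCircles (L : WiringDiagram T) (σ : T → Fin 2) : ℕ :=
  Nat.card (Quot fun a b : T × SiteEnd =>
    b = L.strand a ∨ b = (a.1, (L.type a.1).filling (σ a.1) a.2)) + L.freeCircles

/-- The twist bracket
`P_L(A, x) = ∑_σ (∏_i (x_i - 1) ^ σ_i * d ^ (1 - σ_i)) * ⟨L_σ⟩` of a wiring diagram. -/
noncomputable def twistBracket {K : Type*} [Field K] [Fintype T] [DecidableEq T]
    (L : WiringDiagram T) (A : K) (x : T → K) : K :=
  ∑ σ : T → Fin 2,
    (∏ i, (x i - 1) ^ (σ i : ℕ) * loopValue A ^ (1 - (σ i : ℕ))) *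
      crossinglessBracket A (L.stateCircles σ)

end WiringDiagram

/-! ### The wiring diagram of a coloured graph -/

/-- The colours of the edges: `c` for chains, `s` for sheafs. -/
inductive EdgeColor where
  | c
  | s

/-- A sheaf becomes a vertical vertex, a chain becomes a horizontal vertex. -/
def EdgeColor.twistType : EdgeColor → TwistType
  | .c => .horizontal
  | .s => .vertical

namespace EmbeddedGraph

variable {V E : Type*}

/-- The end of the site on the clockwise side of a dart, seen from its vertex, where the vertices of
the darts `(e, true)` and `(e, false)` lie in the east and in the west of the site on `e`. -/
def clockwiseEnd {E : Type*} : E × Bool → E × SiteEnd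
  | (e, true) => (e, .ne)
  | (e, false) => (e, .sw)

/-- The end of the site on the counterclockwise side of a dart, seen from its vertex. -/
def counterclockwiseEnd {E : Type*} : E × Bool → E × SiteEnd
  | (e, true) => (e, .se)
  | (e, false) => (e, .nw)

/-- Every edge `e` is crossed by the wiring diagram in one site, with the vertex of the dart
`(e, true)` in the east and the vertex of the dart `(e, false)` in the west, so that the regions in
the east and in the west are shaded. The strand on the counterclockwise side of a dart (seen from
its vertex) runs along the boundary of the shaded region to the clockwise side of the next dart. -/
def medialStrand (G : EmbeddedGraph V E) : E × SiteEnd → E × SiteEnd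
  | (e, .se) => clockwiseEnd (G.rot (e, true))
  | (e, .nw) => clockwiseEnd (G.rot (e, false))
  | (e, .ne) => counterclockwiseEnd (G.rot.symm (e, true))
  | (e, .sw) => counterclockwiseEnd (G.rot.symm (e, false))

theorem medialStrand_clockwiseEnd (G : EmbeddedGraph V E) (a : E × Bool) :
    G.medialStrand (clockwiseEnd a) =
      counterclockwiseEnd (G.rot.symm a) := by
  rcases a with ⟨e, _ | _⟩ <;> rfl

theorem medialStrand_counterclockwiseEnd (G : EmbeddedGraph V E) (a : E × Bool) :
    G.medialStrand (counterclockwiseEnd a) =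
      clockwiseEnd (G.rot a) := by
  rcases a with ⟨e, _ | _⟩ <;> rfl

theorem siteEnd_cases {E : Type*} (a : E × SiteEnd) : (∃ b : E × Bool, a = clockwiseEnd b) ∨
    ∃ b : E × Bool, a = counterclockwiseEnd b := by
  rcases a with ⟨e, _ | _ | _ | _⟩
  · exact Or.inl ⟨(e, true), rfl⟩
  · exact Or.inr ⟨(e, false), rfl⟩
  · exact Or.inl ⟨(e, false), rfl⟩
  · exact Or.inr ⟨(e, true), rfl⟩

theorem clockwiseEnd_ne {E : Type*} (a b : E × Bool) :
    clockwiseEnd a ≠ counterclockwiseEnd b := by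
  rcases a with ⟨e, _ | _⟩ <;> rcases b with ⟨f, _ | _⟩ <;>
    simp [clockwiseEnd, counterclockwiseEnd]

/-- The wiring diagram `W_G` of an embedded graph `G` with edges coloured by `c` and `s`: its
vertices are the edges of `G`, and its shaded regions are the vertices of `G`. A vertex of `G`
without edges contributes a closed curve, the boundary of its shaded region. -/
noncomputable def wiringDiagram (G : EmbeddedGraph V E) (color : E → EdgeColor) :
    WiringDiagram E where
  type e := (color e).twistType
  strand := G.medialStrand
  strand_strand a := by
    rcases siteEnd_cases a with ⟨b, rfl⟩ | ⟨b, rfl⟩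
    · rw [medialStrand_clockwiseEnd, medialStrand_counterclockwiseEnd, Equiv.apply_symm_apply]
    · rw [medialStrand_counterclockwiseEnd, medialStrand_clockwiseEnd, Equiv.symm_apply_apply]
  strand_ne a := by
    rcases siteEnd_cases a with ⟨b, rfl⟩ | ⟨b, rfl⟩
    · rw [medialStrand_clockwiseEnd]; exact (clockwiseEnd_ne _ _).symm
    · rw [medialStrand_counterclockwiseEnd]; exact clockwiseEnd_ne _ _
  freeCircles := G.isolatedCount

end EmbeddedGraph

/-! ### The augmented colouring and the evaluation of the variables -/

/-- The augmented colours `c_i` and `s_i`, one pair for each edge `i`. -/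
inductive AugColor (E : Type*) where
  | c : E → AugColor E
  | s : E → AugColor E

/-- The augmented colouring: the edge `i` gets the colour `c_i` or `s_i`. -/
def augment {E : Type*} (color : E → EdgeColor) (i : E) : AugColor E :=
  match color i with
  | .c => .c i
  | .s => .s i

/-- The evaluation `t = z₁ = z₂ = d`, `x_{c_i} = 1`, `y_{c_i} = (x_i - 1) / d`,
`x_{s_i} = (x_i - 1) / d`, `y_{s_i} = 1`. -/
def twistEvaluation {K E : Type*} [Field K] (d : K) (x : E → K) : WVar (AugColor E) → K
  | .t => d
  | .z₁ => d
  | .z₂ => d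
  | .x (.c _) => 1
  | .y (.c i) => (x i - 1) / d
  | .x (.s i) => (x i - 1) / d
  | .y (.s _) => 1

/-! Both sides are sums over spanning subgraphs, and Euler's formula matches them term by term.
Write `k(S)` for the number of components of the spanning subgraph with edge set `S`, and `b(S)` for
the number of boundary curves of its ribbon neighbourhood.

For a connected graph, `eq_subsetSum` expresses `W * z₁ * z₂ ^ |V|` as the sum over `S` of the
`x`-variables on `S` and the `y`-variables off `S`, times `z₁ ^ k(S) * z₂ ^ (|S| + k(S))`. On the
other side, a state is determined by the set `S` of sites at which it connects the shaded regions.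
Its shaded part is the ribbon neighbourhood of `S`, so it consists of `b(S)` curves
(`stateCircles_wiringDiagram`). The edge weights agree up to one factor `d` per edge, and the powers
of `d` agree because `b(S) + |V| = 2 k(S) + |S|`.

This last identity (`boundaryCount_add_card`) is Euler's formula for every spanning subgraph,
whereas planarity is assumed only for the whole graph. The defect in the formula does not decrease
when an edge is added (`genusDefect_le_insert`). It vanishes for the empty set and, by planarity,
for the full edge set, hence for every set in between. The boundary curves are the cycles of a
permutation of the darts, and adding an edge composes it with a transposition, so everything reduces
to how a transposition changes the number of cycles. -/

/-! ### Cycle counts of permutations under composition with a transposition. -/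

theorem Equiv.Perm.sameCycle_swap_mul {X : Type*} [Finite X] [DecidableEq X] {p : Equiv.Perm X}
    {a b : X} (h : ¬ p.SameCycle a b) : (Equiv.swap a b * p).SameCycle a b := by
  by_contra h'
  -- As long as the orbit of `a` under `p` meets neither `a` again nor `b`, the transposition does
  -- not act on it. A return to `a` would be sent to `b`, which is excluded by `h'`.
  have key : ∀ k : ℕ, ((Equiv.swap a b * p) ^ k) a = (p ^ k) a := by
    intro k
    induction k with
    | zero => rfl
    | succ k ih =>
      have hs : ((Equiv.swap a b * p) ^ (k + 1)) a = Equiv.swap a b ((p ^ (k + 1)) a) := by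
        rw [pow_succ', Equiv.Perm.mul_apply, ih, Equiv.Perm.mul_apply, ← Equiv.Perm.mul_apply p,
          ← pow_succ']
      by_cases ha : (p ^ (k + 1)) a = a
      · refine absurd ⟨((k + 1 : ℕ) : ℤ), ?_⟩ h'
        rw [zpow_natCast, hs, ha, Equiv.swap_apply_left]
      · have hb : (p ^ (k + 1)) a ≠ b := fun hb =>
          h ⟨((k + 1 : ℕ) : ℤ), by rw [zpow_natCast, hb]⟩
        rw [hs, Equiv.swap_apply_of_ne_of_ne ha hb]
  -- The orbit does return to `a`, at the latest after `orderOf p` steps; there the transposition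
  -- yields `b`, so `key` forces `a = b`.
  have hpos := orderOf_pos p
  obtain ⟨n, hn⟩ : ∃ n, orderOf p = n + 1 := ⟨_, (Nat.succ_pred_eq_of_pos hpos).symm⟩
  have h1 : (p ^ (n + 1)) a = a := by rw [← hn, pow_orderOf_eq_one]; rfl
  have h2 := key (n + 1)
  rw [pow_succ', Equiv.Perm.mul_apply, key n, Equiv.Perm.mul_apply, ← Equiv.Perm.mul_apply p,
    ← pow_succ', h1, Equiv.swap_apply_left] at h2
  exact h (h2 ▸ Equiv.Perm.SameCycle.refl _ _)

/-- The number of cycles of a permutation, fixed points included. -/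
noncomputable def Equiv.Perm.cycleCount {X : Type*} (p : Equiv.Perm X) : ℕ :=
  Nat.card (Quot fun a b : X => b = p a)

/-- The one-step relation generates the orbit relation, negative powers being reached by symmetry.
Counting cycles through this relation makes `card_quot_add_edge` applicable to permutations. -/
theorem Equiv.Perm.quot_mk_eq_iff {X : Type*} (p : Equiv.Perm X) (a b : X) :
    Quot.mk (fun a b : X => b = p a) a = Quot.mk _ b ↔ p.SameCycle a b := by
  constructor
  · intro h
    exact Quotient.exact (s := Equiv.Perm.SameCycle.setoid p)
      (congrArg (Quot.lift (Quotient.mk (Equiv.Perm.SameCycle.setoid p))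
        (by rintro a _ rfl; exact Quotient.sound ⟨1, by simp⟩)) h)
  · rintro ⟨k, rfl⟩
    induction k with
    | zero => rfl
    | succ k ih =>
      rw [ih, add_comm, zpow_add]
      exact Quot.sound (by simp)
    | pred k ih =>
      rw [ih]
      refine (Quot.sound ?_).symm
      rw [← Equiv.Perm.mul_apply, ← zpow_one_add]
      ring_nf

theorem Equiv.Perm.card_quotient_sameCycle {X : Type*} (p : Equiv.Perm X) :
    Nat.card (Quotient (Equiv.Perm.SameCycle.setoid p)) = p.cycleCount :=
  Nat.card_congr ⟨Quotient.lift (Quot.mk _) fun a b h => (p.quot_mk_eq_iff a b).2 h,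
    Quot.lift (Quotient.mk _) fun a b h => Quotient.sound ((p.quot_mk_eq_iff a b).1 (Quot.sound h)),
    by rintro ⟨a⟩; rfl, by rintro ⟨a⟩; rfl⟩

theorem Equiv.Perm.cycleCount_inv {X : Type*} (p : Equiv.Perm X) :
    p⁻¹.cycleCount = p.cycleCount := by
  rw [← card_quotient_sameCycle, ← card_quotient_sameCycle]
  have : Equiv.Perm.SameCycle.setoid p⁻¹ = Equiv.Perm.SameCycle.setoid p :=
    Setoid.ext fun a b => Equiv.Perm.sameCycle_inv
  rw [this]

/-- Joining two elements by an additional relation gives the same classes for `p` and for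
`swap a b * p`. -/
theorem Equiv.Perm.card_quot_swap_mul {X : Type*} [DecidableEq X] (p : Equiv.Perm X) (a b : X) :
    Nat.card (Quot fun x y => y = (Equiv.swap a b * p) x ∨ (x = a ∧ y = b) ∨ (x = b ∧ y = a)) =
    Nat.card (Quot fun x y => y = p x ∨ (x = a ∧ y = b) ∨ (x = b ∧ y = a)) := by
  -- The images of `x` under `q` and `swap a b * q` differ only if they are `a` and `b`, which are
  -- identified. With `q` arbitrary this gives both directions, since the transposition is an
  -- involution.
  have key : ∀ q : Equiv.Perm X, ∀ x y, (y = (Equiv.swap a b * q) x ∨ (x = a ∧ y = b) ∨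
      (x = b ∧ y = a)) →
      Quot.mk (fun x y => y = q x ∨ (x = a ∧ y = b) ∨ (x = b ∧ y = a)) x = Quot.mk _ y := by
    intro q x y h
    rcases h with rfl | h
    · have h1 : Quot.mk (fun x y => y = q x ∨ (x = a ∧ y = b) ∨ (x = b ∧ y = a)) x =
        Quot.mk _ (q x) := Quot.sound (Or.inl rfl)
      rw [h1, Equiv.Perm.mul_apply]
      by_cases ha : q x = a
      · rw [ha, Equiv.swap_apply_left]; exact Quot.sound (Or.inr (Or.inl ⟨rfl, rfl⟩))
      by_cases hb : q x = b
      · rw [hb, Equiv.swap_apply_right]; exact Quot.sound (Or.inr (Or.inr ⟨rfl, rfl⟩))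
      rw [Equiv.swap_apply_of_ne_of_ne ha hb]
    · exact Quot.sound (Or.inr h)
  refine Nat.card_congr ⟨Quot.lift (Quot.mk _) (key p), Quot.lift (Quot.mk _) fun x y h => ?_,
    by rintro ⟨a⟩; rfl, by rintro ⟨a⟩; rfl⟩
  refine key (Equiv.swap a b * p) x y ?_
  rwa [Equiv.swap_mul_self_mul]

/-- Identifying `a` and `b` leads from either permutation to the same number of classes and lowers
each cycle count by at most one, so the two counts differ by at most one. -/
theorem Equiv.Perm.cycleCount_swap_mul_le {X : Type*} [Finite X] [DecidableEq X]
    (p : Equiv.Perm X) (a b : X) :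
    (Equiv.swap a b * p).cycleCount ≤ p.cycleCount + 1 := by
  have h1 := WPolynomialAux.card_quot_add_edge (r := fun x y => y = p x) (u := a) (v := b)
    (fun _ _ => Iff.rfl)
  have h2 := WPolynomialAux.card_quot_add_edge (r := fun x y => y = (Equiv.swap a b * p) x)
    (u := a) (v := b) (fun _ _ => Iff.rfl)
  rw [Equiv.Perm.card_quot_swap_mul] at h2
  unfold Equiv.Perm.cycleCount
  by_cases c1 : Quot.mk (fun x y => y = p x) a = Quot.mk _ b <;>
  by_cases c2 : Quot.mk (fun x y => y = (Equiv.swap a b * p) x) a = Quot.mk _ b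
  · have := h1.1 c1; have := h2.1 c2; omega
  · have := h1.1 c1; have := h2.2 c2; omega
  · have := h1.2 c1; have := h2.1 c2; omega
  · have := h1.2 c1; have := h2.2 c2; omega

/-- The transposition merges the two cycles: afterwards `a` and `b` share a cycle, so identifying
them loses nothing, whereas before it loses exactly one class. -/
theorem Equiv.Perm.cycleCount_swap_mul_of_not_sameCycle {X : Type*} [Finite X] [DecidableEq X]
    {p : Equiv.Perm X} {a b : X} (h : ¬ p.SameCycle a b) :
    (Equiv.swap a b * p).cycleCount + 1 = p.cycleCount := by
  have h1 := (WPolynomialAux.card_quot_add_edge (r := fun x y => y = p x) (u := a) (v := b)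
    (fun _ _ => Iff.rfl)).2 (fun e => h ((p.quot_mk_eq_iff a b).1 e))
  have h2 := (WPolynomialAux.card_quot_add_edge (r := fun x y => y = (Equiv.swap a b * p) x)
    (u := a) (v := b) (fun _ _ => Iff.rfl)).1
      ((Equiv.Perm.quot_mk_eq_iff _ a b).2 (Equiv.Perm.sameCycle_swap_mul h))
  rw [Equiv.Perm.card_quot_swap_mul] at h2
  unfold Equiv.Perm.cycleCount
  omega

/-! ### Boundary curves of spanning subgraphs. -/

namespace EmbeddedGraph

variable {V E : Type*}

/-- The involution of the darts that exchanges the two darts of every edge in `S`. -/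
def flip [DecidableEq E] (S : Finset E) : Equiv.Perm (E × Bool) :=
  Function.Involutive.toPerm (fun a => if a.1 ∈ S then (a.1, !a.2) else a) (by
    rintro ⟨e, b⟩
    by_cases h : e ∈ S <;> simp [h])

theorem flip_apply [DecidableEq E] (S : Finset E) (a : E × Bool) :
    flip S a = if a.1 ∈ S then (a.1, !a.2) else a := rfl

theorem flip_flip [DecidableEq E] (S : Finset E) (a : E × Bool) : flip S (flip S a) = a := by
  rcases a with ⟨e, b⟩
  by_cases h : e ∈ S <;> simp [flip_apply, h]

theorem flip_insert [DecidableEq E] {S : Finset E} {e : E} (he : e ∉ S) :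
    flip (insert e S) = Equiv.swap (e, false) (e, true) * flip S := by
  ext1 ⟨f, b⟩
  rw [Equiv.Perm.mul_apply, flip_apply, flip_apply]
  by_cases hf : f = e
  · subst hf
    cases b <;> simp [he]
  · by_cases hS : f ∈ S
    · simp only [hS, Finset.mem_insert, or_true, if_true]
      rw [Equiv.swap_apply_of_ne_of_ne] <;> simp [hf]
    · simp only [hS, Finset.mem_insert, hf, or_false, if_false]
      rw [Equiv.swap_apply_of_ne_of_ne] <;> simp [hf]

/-- The number of boundary curves of the ribbon neighbourhood of the spanning subgraph with
edge set `S`. -/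
noncomputable def boundaryCount [DecidableEq E] (G : EmbeddedGraph V E) (S : Finset E) : ℕ :=
  (flip S * G.rot).cycleCount + G.isolatedCount

/-- Without edges every boundary curve encircles one vertex: the cycles of the rotation are the
vertices that carry darts, and `isolatedCount` supplies the others. -/
theorem boundaryCount_empty [Finite V] [DecidableEq E] (G : EmbeddedGraph V E) :
    G.boundaryCount ∅ = Nat.card V := by
  have h0 : flip (∅ : Finset E) * G.rot = G.rot := by
    ext1 a; rw [Equiv.Perm.mul_apply, flip_apply]; simp
  have h1 : G.rot.cycleCount = Nat.card {v : V // ∃ a, G.base a = v} := by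
    rw [← Equiv.Perm.card_quotient_sameCycle]
    refine Nat.card_congr (Equiv.ofBijective (Quotient.lift (fun a => ⟨G.base a, a, rfl⟩)
      fun a b h => Subtype.ext ((G.sameCycle_iff a b).1 h)) ⟨?_, ?_⟩)
    · rintro ⟨a⟩ ⟨b⟩ h
      exact Quotient.sound ((G.sameCycle_iff a b).2 (congrArg Subtype.val h))
    · rintro ⟨v, a, rfl⟩
      exact ⟨Quotient.mk _ a, rfl⟩
  unfold boundaryCount isolatedCount
  rw [h0, h1]
  classical
  have h2 := Nat.card_congr (Equiv.sumCompl fun v : V => ∃ a, G.base a = v)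
  rw [Nat.card_sum] at h2
  rw [← h2]
  simp only [not_exists, ne_eq]

/-- With all edges present the boundary curves are the face boundaries, walked in the opposite
direction; hence the inverse. -/
theorem boundaryCount_univ [Fintype E] [DecidableEq E] (G : EmbeddedGraph V E) :
    G.boundaryCount Finset.univ = G.faceCount := by
  unfold boundaryCount faceCount
  rw [Equiv.Perm.card_quotient_sameCycle, ← Equiv.Perm.cycleCount_inv]
  have : (flip Finset.univ * G.rot)⁻¹ = G.facePerm := by
    rw [inv_eq_iff_mul_eq_one]
    ext1 ⟨e, b⟩
    simp [facePerm, flip_apply]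
  rw [this]

theorem isLink_base (G : EmbeddedGraph V E) (e : E) :
    G.graph.IsLink e (G.base (e, false)) (G.base (e, true)) := Or.inl ⟨rfl, rfl⟩

theorem base_rot (G : EmbeddedGraph V E) (a : E × Bool) : G.base (G.rot a) = G.base a :=
  ((G.sameCycle_iff a (G.rot a)).1 ⟨1, by simp⟩).symm

/-- The darts along a boundary curve sit at vertices in the same component. -/
theorem quot_base_eq_of_sameCycle [DecidableEq E] (G : EmbeddedGraph V E) {S : Finset E}
    {a b : E × Bool} (h : (flip S * G.rot).SameCycle a b) :
    Quot.mk (fun u v : (G.graph.restrict (S : Set E)).vertexSet =>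
        (G.graph.restrict (S : Set E)).Adj u v) ⟨G.base a, trivial⟩ =
      Quot.mk _ ⟨G.base b, trivial⟩ := by
  refine congrArg (Quot.lift (fun a => Quot.mk (fun u v :
    (G.graph.restrict (S : Set E)).vertexSet => (G.graph.restrict (S : Set E)).Adj u v)
      ⟨G.base a, trivial⟩) ?_) ((Equiv.Perm.quot_mk_eq_iff _ a b).2 h)
  rintro a _ rfl
  -- The rotation stays at the vertex, and the flip either stays there or crosses an edge of `S`.
  have hrot : (⟨G.base a, trivial⟩ : (G.graph.restrict (S : Set E)).vertexSet) =
    ⟨G.base (G.rot a), trivial⟩ := Subtype.ext (G.base_rot a).symm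
  rw [hrot, Equiv.Perm.mul_apply, flip_apply]
  rcases G.rot a with ⟨e, c⟩
  by_cases he : e ∈ S
  · simp only [he, if_true]
    refine Quot.sound ⟨e, ?_⟩
    simp only [Graph.restrict_isLink, Finset.mem_coe]
    refine ⟨he, ?_⟩
    cases c
    · exact G.isLink_base e
    · exact (G.isLink_base e).symm
  · simp only [he, if_false]

theorem componentCount_restrict_empty (G : EmbeddedGraph V E) :
    (G.graph.restrict ∅).componentCount = Nat.card V := by
  rw [WPolynomialAux.componentCount_edgeless (by simp)]
  exact Set.ncard_univ V

theorem restrict_univ (G : EmbeddedGraph V E) : G.graph.restrict Set.univ = G.graph :=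
  Graph.ext rfl fun e u v => by simp

/-! ### Euler's formula for spanning subgraphs. -/

/-- The number by which the Euler characteristic of the ribbon neighbourhood of a spanning
subgraph, with its boundary curves capped off, is less than that of a disjoint union of spheres. -/
noncomputable def genusDefect [DecidableEq E] (G : EmbeddedGraph V E) (S : Finset E) : ℤ :=
  2 * (G.graph.restrict (S : Set E)).componentCount + S.card - Nat.card V - G.boundaryCount S

theorem genusDefect_le_insert [Finite V] [Finite E] [DecidableEq E] (G : EmbeddedGraph V E)
    {S : Finset E} {e : E} (he : e ∉ S) : G.genusDefect S ≤ G.genusDefect (insert e S) := by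
  have heS : e ∉ (S : Set E) := by simpa using he
  have hl : (G.graph.restrict (insert e (S : Set E))).IsLink e (G.base (e, false))
      (G.base (e, true)) := by simp [G.isLink_base e]
  have hk := WPolynomialAux.componentCount_add_edge (K := G.graph.restrict (S : Set E))
    (K' := G.graph.restrict (insert e (S : Set E))) (u := G.base (e, false))
    (v := G.base (e, true)) rfl trivial trivial (by
      have := WPolynomialAux.adj_iff_of_link hl
      rwa [WPolynomialAux.restrict_insert_delete heS, WPolynomialAux.restrict_delete heS] at this)
  unfold genusDefect boundaryCount
  rw [Finset.card_insert_of_notMem he, Finset.coe_insert, flip_insert he, mul_assoc]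
  by_cases hc : Quot.mk (fun u v : (G.graph.restrict (S : Set E)).vertexSet =>
      (G.graph.restrict (S : Set E)).Adj u v) ⟨G.base (e, false), trivial⟩ =
      Quot.mk _ ⟨G.base (e, true), trivial⟩
  -- Ends already connected: `k` is unchanged, `|S|` grows by one and the boundary count by at most
  -- one.
  · have h1 := hk.1 hc
    have h2 := Equiv.Perm.cycleCount_swap_mul_le (flip S * G.rot) (e, false) (e, true)
    push_cast
    omega
  -- Ends in different components: no boundary curve visits both darts, so `k` and the boundary
  -- count each drop by one and the defect is unchanged.
  · have h1 := hk.2 hc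
    have h2 := Equiv.Perm.cycleCount_swap_mul_of_not_sameCycle
      (fun h => hc (G.quot_base_eq_of_sameCycle h))
    push_cast
    omega

theorem genusDefect_mono [Finite V] [Finite E] [DecidableEq E] (G : EmbeddedGraph V E) :
    Monotone G.genusDefect :=
  Finset.monotone_iff_forall_le_insert.2 fun _ _ he => G.genusDefect_le_insert he

/-- Spanning subgraphs of plane graphs are plane: Euler's formula for the number of boundary
curves. -/
theorem boundaryCount_add_card [Finite V] [Fintype E] [DecidableEq E] (G : EmbeddedGraph V E)
    (hplane : G.IsPlane) (S : Finset E) :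
    G.boundaryCount S + Nat.card V =
      2 * (G.graph.restrict (S : Set E)).componentCount + S.card := by
  have h0 : G.genusDefect ∅ = 0 := by
    unfold genusDefect
    rw [Finset.coe_empty, componentCount_restrict_empty, boundaryCount_empty, Finset.card_empty]
    push_cast
    ring
  have h1 : G.genusDefect Finset.univ = 0 := by
    unfold genusDefect
    unfold IsPlane at hplane
    rw [Finset.coe_univ, restrict_univ, boundaryCount_univ, Finset.card_univ]
    rw [Nat.card_eq_fintype_card (α := E)] at hplane
    omega
  -- Monotonicity squeezes the defect of `S` between zero and zero.
  have h2 := G.genusDefect_mono (Finset.empty_subset S)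
  have h3 := G.genusDefect_mono (Finset.subset_univ S)
  unfold genusDefect at h0 h1 h2 h3
  omega

end EmbeddedGraph

/-! ### States of the wiring diagram and spanning subgraphs. -/

/-- The filling that connects the shaded regions at the site of an edge of the given colour. -/
def EdgeColor.connectingFilling : EdgeColor → Fin 2
  | .c => 0
  | .s => 1

theorem EdgeColor.filling_connecting (k : EdgeColor) :
    k.twistType.filling k.connectingFilling = SiteEnd.horizontalArcs := by
  cases k <;> rfl

theorem EdgeColor.filling_of_ne {k : EdgeColor} {a : Fin 2} (h : a ≠ k.connectingFilling) :
    k.twistType.filling a = SiteEnd.verticalArcs := by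
  cases k
  · rw [Fin.eq_one_of_ne_zero a h]; rfl
  · have : a = 0 := by
      have h : a ≠ 1 := h
      omega
    rw [this]; rfl

namespace EmbeddedGraph

variable {V E : Type*}

/-- The edges at which a state connects the two shaded regions. -/
def connectedEdges [Fintype E] (color : E → EdgeColor) (σ : E → Fin 2) : Finset E :=
  Finset.univ.filter fun i => σ i = (color i).connectingFilling

/-- The state that connects the shaded regions exactly at the edges in a given set. -/
def connectingState [DecidableEq E] (color : E → EdgeColor) (S : Finset E) (i : E) : Fin 2 :=
  if i ∈ S then (color i).connectingFilling else 1 - (color i).connectingFilling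

theorem mem_connectedEdges [Fintype E] {color : E → EdgeColor} {σ : E → Fin 2} {i : E} :
    i ∈ connectedEdges color σ ↔ σ i = (color i).connectingFilling := by
  simp [connectedEdges]

theorem connectedEdges_connectingState [Fintype E] [DecidableEq E] (color : E → EdgeColor)
    (S : Finset E) : connectedEdges color (connectingState color S) = S := by
  ext i
  have h2 : ∀ b : Fin 2, 1 - b ≠ b := by decide
  rw [mem_connectedEdges, connectingState]
  by_cases h : i ∈ S <;> simp only [h, if_true, if_false, h2]

theorem connectingState_connectedEdges [Fintype E] [DecidableEq E] (color : E → EdgeColor)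
    (σ : E → Fin 2) : connectingState color (connectedEdges color σ) = σ := by
  ext1 i
  have h2 : ∀ a b : Fin 2, a ≠ b → 1 - b = a := by decide
  rw [connectingState]
  split_ifs with h
  · exact (mem_connectedEdges.1 h).symm
  · exact h2 _ _ fun h' => h (mem_connectedEdges.2 h')

/-- A connecting arc leads from one side of a dart to the opposite side of the other dart of the
edge, along the ribbon; a separating arc turns back around the same dart. -/
theorem siteArc_clockwiseEnd [Fintype E] [DecidableEq E] (color : E → EdgeColor) (σ : E → Fin 2)
    (a : E × Bool) : ((clockwiseEnd a).1, (color (clockwiseEnd a).1).twistType.filling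
      (σ (clockwiseEnd a).1) (clockwiseEnd a).2) =
      counterclockwiseEnd (flip (connectedEdges color σ) a) := by
  rcases a with ⟨e, b⟩
  by_cases h : σ e = (color e).connectingFilling
  · cases b <;> simp [clockwiseEnd, counterclockwiseEnd, flip_apply, connectedEdges, h,
      EdgeColor.filling_connecting, SiteEnd.horizontalArcs]
  · cases b <;> simp [clockwiseEnd, counterclockwiseEnd, flip_apply, connectedEdges, h,
      EdgeColor.filling_of_ne, SiteEnd.verticalArcs]

theorem siteArc_counterclockwiseEnd [Fintype E] [DecidableEq E] (color : E → EdgeColor)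
    (σ : E → Fin 2) (a : E × Bool) :
    ((counterclockwiseEnd a).1, (color (counterclockwiseEnd a).1).twistType.filling
      (σ (counterclockwiseEnd a).1) (counterclockwiseEnd a).2) =
      clockwiseEnd (flip (connectedEdges color σ) a) := by
  rcases a with ⟨e, b⟩
  by_cases h : σ e = (color e).connectingFilling
  · cases b <;> simp [clockwiseEnd, counterclockwiseEnd, flip_apply, connectedEdges, h,
      EdgeColor.filling_connecting, SiteEnd.horizontalArcs]
  · cases b <;> simp [clockwiseEnd, counterclockwiseEnd, flip_apply, connectedEdges, h,
      EdgeColor.filling_of_ne, SiteEnd.verticalArcs]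

/-- The dart from whose counterclockwise end the curve that passes through a given end of a site,
in the state that connects the edges in `S`, continues. -/
def dartOfEnd [DecidableEq E] (S : Finset E) : E × SiteEnd → E × Bool
  | (e, .ne) => flip S (e, true)
  | (e, .sw) => flip S (e, false)
  | (e, .se) => (e, true)
  | (e, .nw) => (e, false)

theorem dartOfEnd_clockwiseEnd [DecidableEq E] (S : Finset E) (a : E × Bool) :
    dartOfEnd S (clockwiseEnd a) = flip S a := by
  rcases a with ⟨e, _ | _⟩ <;> rfl

theorem dartOfEnd_counterclockwiseEnd [DecidableEq E] (S : Finset E) (a : E × Bool) :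
    dartOfEnd S (counterclockwiseEnd a) = a := by
  rcases a with ⟨e, _ | _⟩ <;> rfl

/-- The curves of a state of the wiring diagram are the boundary curves of a spanning subgraph. -/
theorem stateCircles_wiringDiagram [Fintype E] [DecidableEq E] (G : EmbeddedGraph V E)
    (color : E → EdgeColor) (σ : E → Fin 2) :
    (G.wiringDiagram color).stateCircles σ = G.boundaryCount (connectedEdges color σ) := by
  set S := connectedEdges color σ with hS
  unfold WiringDiagram.stateCircles boundaryCount
  refine congrArg (· + G.isolatedCount) ?_
  unfold Equiv.Perm.cycleCount
  have hstrand : (G.wiringDiagram color).strand = G.medialStrand := rfl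
  have htype : ∀ e, (G.wiringDiagram color).type e = (color e).twistType := fun _ => rfl
  simp only [hstrand, htype]
  have hstep : ∀ x, Quot.mk (fun a b => b = (flip S * G.rot) a) (flip S (G.rot x)) =
      Quot.mk _ x := fun x => by
    symm; exact Quot.sound rfl
  -- Along a curve, clockwise and counterclockwise ends alternate. Its counterclockwise ends, in
  -- order of travel, form one cycle of `flip S * G.rot`; a clockwise end is represented by the
  -- counterclockwise end across its arc.
  refine Nat.card_congr ⟨Quot.lift (fun a => Quot.mk _ (dartOfEnd S a)) ?_,
    Quot.lift (fun a => Quot.mk _ (counterclockwiseEnd a)) ?_, ?_, ?_⟩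
  · rintro a _ (rfl | rfl)
    · rcases siteEnd_cases a with ⟨a, rfl⟩ | ⟨a, rfl⟩
      · rw [medialStrand_clockwiseEnd, dartOfEnd_clockwiseEnd, dartOfEnd_counterclockwiseEnd,
          ← hstep (G.rot.symm a), Equiv.apply_symm_apply]
      · rw [medialStrand_counterclockwiseEnd, dartOfEnd_clockwiseEnd,
          dartOfEnd_counterclockwiseEnd, hstep]
    · rcases siteEnd_cases a with ⟨a, rfl⟩ | ⟨a, rfl⟩
      · rw [siteArc_clockwiseEnd, dartOfEnd_clockwiseEnd, dartOfEnd_counterclockwiseEnd]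
      · rw [siteArc_counterclockwiseEnd, dartOfEnd_clockwiseEnd, dartOfEnd_counterclockwiseEnd,
          flip_flip]
  · rintro a _ rfl
    -- One step of the permutation is a strand followed by an arc.
    trans Quot.mk _ (clockwiseEnd (G.rot a))
    · apply Quot.sound
      exact Or.inl (medialStrand_counterclockwiseEnd G a).symm
    · apply Quot.sound
      exact Or.inr (siteArc_clockwiseEnd color σ (G.rot a)).symm
  · rintro ⟨a⟩
    change Quot.mk _ (counterclockwiseEnd (dartOfEnd S a)) = Quot.mk _ a
    rcases siteEnd_cases a with ⟨a, rfl⟩ | ⟨a, rfl⟩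
    · rw [dartOfEnd_clockwiseEnd]
      symm
      apply Quot.sound
      exact Or.inr (siteArc_clockwiseEnd color σ a).symm
    · rw [dartOfEnd_counterclockwiseEnd]
  · rintro ⟨a⟩
    change Quot.mk _ (dartOfEnd S (counterclockwiseEnd a)) = Quot.mk _ a
    rw [dartOfEnd_counterclockwiseEnd]

end EmbeddedGraph

/-! ### Comparison of the two state sums. -/

open WPolynomialAux in
/-- The W-polynomial of a connected multigraph as a sum over spanning subgraphs. -/
theorem wPolynomial_mul_eq_sum {α β Λ : Type*} [Finite α] [Fintype β] [DecidableEq β] (c : β → Λ)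
    (H : Graph α β) (hE : H.edgeSet = Set.univ) (hconn : H.componentCount = 1) :
    wPolynomial c H * (MvPolynomial.X .z₁ * MvPolynomial.X .z₂ ^ H.vertexSet.ncard) =
      ∑ S : Finset β, (∏ e ∈ S, MvPolynomial.X (.x (c e))) *
        (∏ e ∈ Sᶜ, MvPolynomial.X (.y (c e))) *
        (MvPolynomial.X .z₁ ^ (H.restrict (S : Set β)).componentCount *
          MvPolynomial.X .z₂ ^ (S.card + (H.restrict (S : Set β)).componentCount)) := by
  classical
  have hne : H.vertexSet.Nonempty := by
    by_contra h
    have : IsEmpty H.vertexSet := ⟨fun v => h ⟨v.1, v.2⟩⟩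
    have : H.componentCount = 0 := by
      unfold Graph.componentCount
      have : IsEmpty (Quot fun u v : H.vertexSet => H.Adj u v) :=
        ⟨fun q => isEmptyElim q.out⟩
      exact Nat.card_of_isEmpty
    omega
  have h := eq_subsetSum (isWPolynomial_wPolynomial c H hne)
  rw [hconn, pow_one, pow_one] at h
  have h' : wPolynomial c H * (MvPolynomial.X .z₁ * MvPolynomial.X .z₂ ^ H.vertexSet.ncard) =
      subsetSum c H (@Finset.univ β _) := by
    -- For one component, both sides of `eq_subsetSum` carry exactly one factor `t`, which cancels
    -- in the polynomial ring.
    refine mul_left_cancel₀ (MvPolynomial.X_ne_zero WVar.t) ?_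
    have hu : H.edgeSet.toFinset = Finset.univ := by
      ext
      simp [hE]
    rw [hu] at h
    linear_combination h
  rw [h']
  unfold subsetSum
  rw [Finset.powerset_univ]
  refine Finset.sum_congr rfl fun S _ => ?_
  congr 3
  ext e
  simp

theorem theorem3 {V E K : Type*} [Finite V] [Fintype E] [DecidableEq E] [Field K]
    (G : EmbeddedGraph V E) (hplane : G.IsPlane) (hconn : G.graph.componentCount = 1)
    (color : E → EdgeColor) (A : K) (hA : A ≠ 0) (hd : loopValue A ≠ 0) (x : E → K) :
    loopValue A ^ Fintype.card E *
        MvPolynomial.aeval (twistEvaluation (loopValue A) x)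
          (wPolynomial (augment color) G.graph) =
      (G.wiringDiagram color).twistBracket A x := by
  set d := loopValue A with hdd
  have hW := congrArg (MvPolynomial.aeval (twistEvaluation d x))
    (wPolynomial_mul_eq_sum (augment color) G.graph rfl hconn)
  have hn : G.graph.vertexSet.ncard = Nat.card V := Set.ncard_univ V
  simp only [map_mul, map_pow, map_sum, map_prod, MvPolynomial.aeval_X, hn] at hW
  have hz1 : twistEvaluation d x .z₁ = d := rfl
  have hz2 : twistEvaluation d x .z₂ = d := rfl
  rw [hz1, hz2] at hW
  -- The factor `d * d ^ |V|` is the value of `z₁ * z₂ ^ |V|` in the subgraph expansion.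
  refine mul_right_cancel₀ (mul_ne_zero hd (pow_ne_zero (Nat.card V) hd)) ?_
  rw [mul_assoc, hW, Finset.mul_sum]
  unfold WiringDiagram.twistBracket
  rw [Finset.sum_mul]
  refine Finset.sum_bij' (fun S _ => EmbeddedGraph.connectingState color S)
    (fun σ _ => EmbeddedGraph.connectedEdges color σ) (by simp) (by simp)
    (fun S _ => EmbeddedGraph.connectedEdges_connectingState color S)
    (fun σ _ => EmbeddedGraph.connectingState_connectedEdges color σ) fun S _ => ?_
  rw [EmbeddedGraph.stateCircles_wiringDiagram, EmbeddedGraph.connectedEdges_connectingState]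
  -- Edge by edge, the weight in the bracket is `d` times the evaluated variable: `d = d * 1` for
  -- the 0-filling and `x i - 1 = d * ((x i - 1) / d)` for the 1-filling.
  have hweight : ∏ i, (x i - 1) ^ (EmbeddedGraph.connectingState color S i : ℕ) *
        d ^ (1 - (EmbeddedGraph.connectingState color S i : ℕ)) =
      d ^ Fintype.card E * ((∏ e ∈ S, twistEvaluation d x (.x (augment color e))) *
        ∏ e ∈ Sᶜ, twistEvaluation d x (.y (augment color e))) := by
    rw [Fintype.card, ← Finset.prod_const, ← Finset.prod_mul_prod_compl S,
      ← Finset.prod_mul_prod_compl S (fun _ => d), mul_mul_mul_comm, ← Finset.prod_mul_distrib,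
      ← Finset.prod_mul_distrib]
    congr 1
    · refine Finset.prod_congr rfl fun e he => ?_
      simp only [EmbeddedGraph.connectingState, he, if_true, augment]
      cases color e <;> simp [EdgeColor.connectingFilling, twistEvaluation, mul_div_cancel₀, hd]
    · refine Finset.prod_congr rfl fun e he => ?_
      simp only [EmbeddedGraph.connectingState, Finset.mem_compl.1 he, if_false, augment]
      cases color e <;> simp [EdgeColor.connectingFilling, twistEvaluation, mul_div_cancel₀, hd]
  rw [hweight, mul_assoc _ (crossinglessBracket A _), mul_assoc (d ^ _)]
  congr 2
  have hcount := G.boundaryCount_add_card hplane S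
  unfold crossinglessBracket
  -- The bracket has the integer exponent `b(S) - 1`, so exponents are compared in `ℤ`: `(b(S) - 1)
  -- + (|V| + 1) = k(S) + (|S| + k(S))`.
  rw [← hdd, ← pow_add, ← pow_succ', ← zpow_natCast, ← zpow_natCast, ← zpow_add₀ hd]
  congr 1
  push_cast
  omega
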